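/- Let $G$ be a finite solvable group of odd order such that, for every prime $p$ dividing $|G|$, each Sylow $p$-subgroup of $G$ has a cyclic or dihedral subgroup of prime index. (As $|G|$ is odd, the dihedral alternative does not in fact occur.) Then $G$ is a semidirect product $G = C{:}D$, that is, there are subgroups $C \trianglelefteq G$ and $D \le G$ with $G = CD$ and $C \cap D = 1$, such that $C$ is abelian, $D$ is nilpotent, and $C \cap \mathbf{Z}(G) = 1$, where $\mathbf{Z}(G)$ is the centre of $G$. (Here $C = 1$ or $D = 1$ is allowed.) -/

import Mathlib

/-- A group is dihedral if it is isomorphic to the dihedral group of order `2 * n` for some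
positive integer `n`. -/
def IsDihedralGroup (H : Type*) [Group H] : Prop :=
  ∃ n : ℕ, 0 < n ∧ Nonempty (H ≃* DihedralGroup n)

/-- Each (nontrivial) Sylow subgroup of `G` has a cyclic or dihedral subgroup of prime index.
Only the primes dividing `|G|` are considered, since the trivial group has no subgroup of prime
index. -/
def SylowCyclicOrDihedral (G : Type*) [Group G] : Prop :=
  ∀ p : ℕ, p.Prime → p ∣ Nat.card G → ∀ P : Sylow p G,
    ∃ H : Subgroup P, H.index.Prime ∧ (IsCyclic H ∨ IsDihedralGroup H)

/-- `G = A : B` (internal, split): `A` is normal in `G`, and every element of `G` is `a * b` for a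
unique pair of `a ∈ A`, `b ∈ B`; in particular `G ⧸ A ≃* B`. -/
def IsInternalSemidirect {G : Type*} [Group G] (A B : Subgroup G) : Prop :=
  A.Normal ∧ A.IsComplement' B

/-! Take `C` to be the nilpotent residual, the last term of the lower central series. Then `G ⧸ C`
is nilpotent, and so is any complement `D`. Two facts remain.

An abelian residual `A` of a finite group splits and avoids the centre
(`IsNilpotentResidual.splitsCentrally`). In a minimal counterexample every `G`-endomorphism of `A`
is onto or trivial, so `A` has prime exponent `p`, and elements central modulo `A` centralize `A`.
Since `G` is not a `p`-group, a central element of prime order `q ≠ p` of `G ⧸ A` lifts to a central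
element of order `q` of `G`. Dividing it out allows induction.

The residual `R` is abelian (`IsNilpotentResidual.commute_of_almostCyclic`). In a minimal
counterexample `N = ⁅R, R⁆` is the unique minimal normal subgroup, elementary abelian of order at
most `p ^ 2`. A two-dimensional linear argument in odd order shows that `R` centralizes `N`, so `R`
is a `p`-group of class two with a large cyclic subgroup. Such a nonabelian group has a noncentral
`y` fixed modulo `N` by all automorphisms. Then `yN` is central in `G ⧸ N` and lies in its abelian
residual `R/N`, contrary to the first fact. -/

open Subgroup
open scoped commutatorElement

/-! ### The nilpotent residual -/

/-- `A` is the nilpotent residual of `G`: it contains a term of the lower central series, and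
`⁅A, G⁆ = A`. -/
structure IsNilpotentResidual {G : Type*} [Group G] (A : Subgroup G) : Prop where
  exists_le : ∃ k, (⊤ : Subgroup G).lowerCentralSeries k ≤ A
  commutator_eq : ⁅A, (⊤ : Subgroup G)⁆ = A

namespace IsNilpotentResidual

variable {G H : Type*} [Group G] [Group H] {A : Subgroup G}

theorem normal (hA : IsNilpotentResidual A) : A.Normal :=
  commutator_top_right_le_iff.1 hA.commutator_eq.le

theorem le_lowerCentralSeries (hA : IsNilpotentResidual A) (k : ℕ) :
    A ≤ (⊤ : Subgroup G).lowerCentralSeries k := by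
  induction k with
  | zero => simp
  | succ k ih =>
    rw [Subgroup.lowerCentralSeries_succ, ← hA.commutator_eq]
    exact commutator_mono ih le_rfl

theorem map (hA : IsNilpotentResidual A) (f : G →* H) (hf : Function.Surjective f) :
    IsNilpotentResidual (A.map f) where
  exists_le := by
    obtain ⟨k, hk⟩ := hA.exists_le
    refine ⟨k, ?_⟩
    rw [← map_top_of_surjective f hf, ← map_lowerCentralSeries]
    exact map_mono hk
  commutator_eq := by
    conv_rhs => rw [← hA.commutator_eq]
    rw [map_commutator, map_top_of_surjective f hf]

theorem isNilpotent_quotient (hA : IsNilpotentResidual A) [A.Normal] :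
    Group.IsNilpotent (G ⧸ A) := by
  obtain ⟨k, hk⟩ := hA.exists_le
  rw [Subgroup.nilpotent_iff_lowerCentralSeries]
  refine ⟨k, ?_⟩
  rw [← map_top_of_surjective _ (QuotientGroup.mk'_surjective A), ← map_lowerCentralSeries,
    Subgroup.map_eq_bot_iff]
  simpa using hk

-- The lower central series of a finite group becomes stationary; its last term qualifies.
variable (G) in
theorem exists_of_finite [Finite G] : ∃ A : Subgroup G, IsNilpotentResidual A := by
  obtain ⟨n, hn⟩ := WellFoundedGT.monotone_chain_condition
    (α := (Subgroup G)ᵒᵈ) ⟨fun n => OrderDual.toDual ((⊤ : Subgroup G).lowerCentralSeries n),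
      fun a b h => (⊤ : Subgroup G).lowerCentralSeries_antitone h⟩
  refine ⟨(⊤ : Subgroup G).lowerCentralSeries n, ⟨n, le_rfl⟩, ?_⟩
  rw [← Subgroup.lowerCentralSeries_succ]
  exact (hn (n + 1) (Nat.le_succ n)).symm

end IsNilpotentResidual

/-! ### Central elements of nilpotent groups -/

/-- A nontrivial normal subgroup of a nilpotent group meets the centre. -/
theorem Subgroup.Normal.inf_center_ne_bot_of_isNilpotent {G : Type*} [Group G]
    [Group.IsNilpotent G] {H : Subgroup G} (hH : H.Normal) (hne : H ≠ ⊥) :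
    H ⊓ center G ≠ ⊥ := by
  intro h0
  apply hne
  obtain ⟨n, hn⟩ := Group.IsNilpotent.nilpotent G
  -- If `H` misses the `k`-th centre, commutators of `x ∈ H` in the next one are trivial, so `x` is
  -- central and `h0` applies.
  have key : ∀ k, H ⊓ upperCentralSeries G k = ⊥ := by
    intro k
    induction k with
    | zero => simp
    | succ k ih =>
      rw [eq_bot_iff]
      rintro x ⟨hx, hxk⟩
      rw [← h0]
      refine ⟨hx, mem_center_iff.2 fun g => ?_⟩
      have hx' := mem_upperCentralSeries_succ_iff.1 hxk g
      have : x * g * x⁻¹ * g⁻¹ ∈ H ⊓ upperCentralSeries G k := by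
        refine ⟨?_, hx'⟩
        have := H.mul_mem hx (hH.conj_mem _ (H.inv_mem hx) g)
        simpa [mul_assoc] using this
      rw [ih, mem_bot] at this
      have := commutatorElement_eq_one_iff_mul_comm.1 (this : ⁅x, g⁆ = 1)
      exact this.symm
  simpa [hn] using key n

/-- In a finite nilpotent group each prime divisor of the order is the order of a central
element. -/
theorem Group.IsNilpotent.exists_mem_center_orderOf_eq {G : Type*} [Group G] [Finite G]
    [Group.IsNilpotent G] {q : ℕ} (hq : q.Prime) (hdvd : q ∣ Nat.card G) :
    ∃ g ∈ center G, orderOf g = q := by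
  have := Fact.mk hq
  let S : Sylow q G := default
  have hS : (S : Subgroup G) ≠ ⊥ := S.ne_bot_of_dvd_card hdvd
  have hne := Subgroup.Normal.inf_center_ne_bot_of_isNilpotent
    (inferInstance : (S : Subgroup G).Normal) hS
  have hp : IsPGroup q ((S : Subgroup G) ⊓ center G : Subgroup G) :=
    S.isPGroup'.to_le inf_le_left
  have hd : q ∣ Nat.card ((S : Subgroup G) ⊓ center G : Subgroup G) := by
    obtain ⟨n, hn⟩ := hp.exists_card_eq
    rcases n with _ | n
    · exact absurd (Subgroup.card_eq_one.1 (by simpa using hn)) hne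
    · rw [hn, pow_succ]; exact dvd_mul_left _ _
  obtain ⟨g, hg⟩ := exists_prime_orderOf_dvd_card' q hd
  exact ⟨g, g.2.2, by rw [Subgroup.orderOf_coe, hg]⟩

/-! ### Splitting: passage between `G`, its quotients and its subgroups -/

/-- `A` has a complement in `G` and meets the centre of `G` trivially. -/
structure SplitsCentrally {G : Type*} [Group G] (A : Subgroup G) : Prop where
  exists_compl : ∃ D : Subgroup G, A ⊓ D = ⊥ ∧ A ⊔ D = ⊤
  inf_center : A ⊓ center G = ⊥

section Splitting

variable {G : Type*} [Group G] {A : Subgroup G}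

/-- The image of the nilpotent residual `A` under a `G`-equivariant endomorphism `φ` satisfies
`⁅φ(A), G⁆ = φ(A)`. -/
theorem IsNilpotentResidual.commutator_range_eq (hA : IsNilpotentResidual A) (φ : A →* G)
    (hφ : ∀ (x : G) (a b : A), (b : G) = x * a * x⁻¹ → φ b = x * φ a * x⁻¹) :
    ⁅φ.range, (⊤ : Subgroup G)⁆ = φ.range := by
  have hn := hA.normal
  apply le_antisymm
  · rw [commutator_top_right_le_iff]
    refine ⟨?_⟩
    rintro _ ⟨a, rfl⟩ x
    exact ⟨⟨x * a * x⁻¹, hn.conj_mem _ a.2 x⟩, hφ x a _ rfl⟩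
  -- `A` is generated by the elements `⁅a, x⁆`, and equivariance gives `φ ⁅a, x⁆ = ⁅φ a, x⁆`.
  · have h : A ≤ (comap φ ⁅φ.range, (⊤ : Subgroup G)⁆).map A.subtype := by
      conv_lhs => rw [← hA.commutator_eq]
      rw [commutator_le]
      intro a ha x _
      let a' : A := ⟨a, ha⟩
      let b : A := ⟨x * a * x⁻¹, hn.conj_mem _ ha x⟩
      refine mem_map.2 ⟨a' * b⁻¹, ?_, ?_⟩
      · change φ (a' * b⁻¹) ∈ ⁅φ.range, (⊤ : Subgroup G)⁆
        rw [map_mul, map_inv, hφ x a' b rfl]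
        have : φ a' * (x * φ a' * x⁻¹)⁻¹ = ⁅φ a', x⁆ := by
          rw [commutatorElement_def]; group
        rw [this]
        exact commutator_mem_commutator (MonoidHom.mem_range.2 ⟨a', rfl⟩) (mem_top x)
      · simp [a', b, commutatorElement_def, mul_assoc]
    rintro _ ⟨a, rfl⟩
    obtain ⟨c, hc, hca⟩ := h a.2
    have : c = a := Subtype.ext hca
    rw [← this]; exact hc

/-- Splitting along a normal subgroup `B ≤ A` with `⁅B, G⁆ = B`. -/
theorem SplitsCentrally.of_le (hA : IsNilpotentResidual A) (hcomm : ∀ a ∈ A, ∀ b ∈ A, a * b = b * a)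
    {B : Subgroup G} [B.Normal] (hBA : B ≤ A) (hB : ⁅B, (⊤ : Subgroup G)⁆ = B)
    (hquot : SplitsCentrally (A.map (QuotientGroup.mk' B)))
    (hsub : ∀ E : Subgroup G, A ⊓ E = B → A ⊔ E = ⊤ → IsNilpotentResidual (B.subgroupOf E) →
      SplitsCentrally (B.subgroupOf E)) :
    SplitsCentrally A := by
  obtain ⟨⟨D', h1, h2⟩, hc⟩ := hquot
  set π := QuotientGroup.mk' B with hπ
  have hker : ∀ b, π b = 1 ↔ b ∈ B := fun b => QuotientGroup.eq_one_iff b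
  set E := D'.comap π with hE
  have hBE : B ≤ E := fun b hb => by
    rw [hE, mem_comap, (hker b).2 hb]; exact D'.one_mem
  have hAE : A ⊓ E = B := by
    apply le_antisymm
    · rintro a ⟨ha, hae⟩
      rw [← hker, ← mem_bot, ← h1]
      exact ⟨mem_map_of_mem _ ha, hae⟩
    · exact le_inf hBA hBE
  have hAE' : A ⊔ E = ⊤ := by
    have hk : π.ker ≤ A ⊔ E := fun b hb => (hBE.trans le_sup_right) ((hker b).1 hb)
    rw [← comap_map_eq_self hk, Subgroup.map_sup, hE,
      map_comap_eq_self_of_surjective (QuotientGroup.mk'_surjective B), h2, comap_top]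
  have hmul : ∀ g : G, ∃ e ∈ E, ∃ a ∈ A, g = e * a := by
    have hn := hA.normal
    intro g
    have hg : g ∈ E ⊔ A := by rw [sup_comm, hAE']; trivial
    obtain ⟨e, he, a, ha, h⟩ := (mem_sup_of_normal_right).1 hg
    exact ⟨e, he, a, ha, h.symm⟩
  have hres : IsNilpotentResidual (B.subgroupOf E) := by
    constructor
    · obtain ⟨k, hk⟩ := hA.exists_le
      refine ⟨k, fun e he => ?_⟩
      have h3 : (e : G) ∈ (⊤ : Subgroup G).lowerCentralSeries k := by
        have := (map_lowerCentralSeries (⊤ : Subgroup E) E.subtype k).le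
          (mem_map_of_mem E.subtype he)
        exact lowerCentralSeries_mono k le_top this
      rw [mem_subgroupOf, ← hAE]
      exact ⟨hk h3, e.2⟩
    · apply Subgroup.map_injective E.subtype_injective
      rw [map_commutator, subgroupOf_map_subtype, inf_eq_left.2 hBE, ← MonoidHom.range_eq_map,
        range_subtype]
      apply le_antisymm ((commutator_mono le_rfl le_top).trans hB.le)
      -- As `G = EA` and `A` centralizes `B`, commutators of `B` with `G` are already commutators
      -- with `E`.
      conv_lhs => rw [← hB]
      rw [commutator_le]
      intro b hb g _
      obtain ⟨e, he, a, ha, rfl⟩ := hmul g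
      have : ⁅b, e * a⁆ = ⁅b, e⁆ := by
        rw [commutatorElement_mul_right_eq_mul_conj,
          commutatorElement_eq_one_iff_mul_comm.2 (hcomm b (hBA hb) a ha)]
        simp
      rw [this]
      exact commutator_mem_commutator hb he
  obtain ⟨⟨D₂, h3, h4⟩, hc2⟩ := hsub E hAE hAE' hres
  refine ⟨⟨D₂.map E.subtype, ?_, ?_⟩, ?_⟩
  · rw [eq_bot_iff]
    rintro _ ⟨ha, d, hd, rfl⟩
    have : d ∈ B.subgroupOf E ⊓ D₂ := ⟨hAE.le ⟨ha, d.2⟩, hd⟩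
    rw [h3, mem_bot] at this
    simp [this]
  -- A complement of `B` in `E` is also one of `A` in `G`.
  · rw [eq_top_iff, ← hAE']
    refine sup_le le_sup_left ?_
    have : E = B ⊔ D₂.map E.subtype := by
      have := congrArg (map E.subtype) h4
      rw [Subgroup.map_sup, subgroupOf_map_subtype, inf_eq_left.2 hBE, ← MonoidHom.range_eq_map,
        range_subtype] at this
      exact this.symm
    exact this.le.trans (sup_le_sup_right hBA _)
  · rw [eq_bot_iff]
    rintro c ⟨hcA, hcZ⟩
    have hcB : c ∈ B := by
      rw [← hker, ← mem_bot, ← hc]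
      refine ⟨mem_map_of_mem _ hcA, mem_center_iff.2 fun y => ?_⟩
      obtain ⟨y, rfl⟩ := QuotientGroup.mk'_surjective B y
      rw [← map_mul, ← map_mul, mem_center_iff.1 hcZ y]
    have : (⟨c, hBE hcB⟩ : E) ∈ B.subgroupOf E ⊓ center E :=
      ⟨hcB, mem_center_iff.2 fun y => Subtype.ext (mem_center_iff.1 hcZ y)⟩
    rw [hc2, mem_bot] at this
    simpa using congrArg Subtype.val this

/-- Splitting modulo a normal subgroup that meets `A` trivially. -/
theorem SplitsCentrally.of_disjoint {N : Subgroup G} [N.Normal] (hN : A ⊓ N = ⊥)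
    (hquot : SplitsCentrally (A.map (QuotientGroup.mk' N))) : SplitsCentrally A := by
  obtain ⟨⟨D', h1, h2⟩, hc⟩ := hquot
  set π := QuotientGroup.mk' N with hπ
  have hker : ∀ b, π b = 1 ↔ b ∈ N := fun b => QuotientGroup.eq_one_iff b
  have hone : ∀ a ∈ A, π a = 1 → a = 1 := fun a ha h => by
    rw [← mem_bot, ← hN]; exact ⟨ha, (hker a).1 h⟩
  refine ⟨⟨D'.comap π, ?_, ?_⟩, ?_⟩
  · rw [eq_bot_iff]
    rintro a ⟨ha, hae⟩
    refine hone a ha ?_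
    rw [← mem_bot, ← h1]
    exact ⟨mem_map_of_mem _ ha, hae⟩
  · have hk : π.ker ≤ A ⊔ D'.comap π := fun b hb =>
      le_sup_right (a := A) (by rw [mem_comap, (hb : π b = 1)]; exact D'.one_mem)
    rw [← comap_map_eq_self hk, Subgroup.map_sup,
      map_comap_eq_self_of_surjective (QuotientGroup.mk'_surjective N), h2, comap_top]
  · rw [eq_bot_iff]
    rintro c ⟨hcA, hcZ⟩
    refine hone c hcA ?_
    rw [← mem_bot, ← hc]
    refine ⟨mem_map_of_mem _ hcA, mem_center_iff.2 fun y => ?_⟩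
    obtain ⟨y, rfl⟩ := QuotientGroup.mk'_surjective N y
    rw [← map_mul, ← map_mul, mem_center_iff.1 hcZ y]

/-- The endomorphism `a ↦ ⁅g, a⁆` of an abelian normal subgroup. -/
def commutatorHom (A : Subgroup G) (hn : A.Normal) (hcomm : ∀ a ∈ A, ∀ b ∈ A, a * b = b * a)
    (g : G) : A →* G where
  toFun a := ⁅g, (a : G)⁆
  map_one' := by simp
  map_mul' a b := by
    have h : ⁅g, (b : G)⁆ ∈ A := by
      have := A.mul_mem (hn.conj_mem _ b.2 g) (A.inv_mem b.2)
      simpa [commutatorElement_def] using this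
    rw [coe_mul, commutatorElement_mul_right_eq_mul_conj, mul_assoc, mul_assoc,
      ← mul_assoc (a : G), hcomm a a.2 _ h]
    group

end Splitting

/-! ### Splitting of an abelian nilpotent residual -/

section Splitting

universe u

variable {G : Type u} [Group G]

theorem Subgroup.card_quotient_lt_of_ne_bot [Finite G] {N : Subgroup G} (hN : N ≠ ⊥) :
    Nat.card (G ⧸ N) < Nat.card G := by
  rw [card_eq_card_quotient_mul_card_subgroup N]
  exact lt_mul_of_one_lt_right Nat.card_pos (one_lt_card_iff_ne_bot _ |>.2 hN)

theorem Subgroup.card_lt_of_ne_top [Finite G] {E : Subgroup G} (hE : E ≠ ⊤) :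
    Nat.card E < Nat.card G :=
  lt_of_le_of_ne (card_le_card_group E) fun h => hE (eq_top_of_card_eq E h)

/-- If `g` is central modulo the abelian normal subgroup `A` and `a ↦ ⁅g, a⁆` maps `A` onto `A`,
then the centralizer of `g` is a complement of `A`. -/
theorem SplitsCentrally.of_commutatorHom_range [Finite G] {A : Subgroup G} (hn : A.Normal)
    (hcomm : ∀ a ∈ A, ∀ b ∈ A, a * b = b * a) {g : G} (hg : ∀ x, ⁅g, x⁆ ∈ A)
    (hr : (commutatorHom A hn hcomm g).range = A) : SplitsCentrally A := by
  set φ := commutatorHom A hn hcomm g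
  have hinj : Function.Injective φ := by
    have h1 : Nat.card φ.range = Nat.card A := by rw [hr]
    have h2 : Function.Bijective φ.rangeRestrict :=
      (Nat.bijective_iff_surjective_and_card _).2 ⟨φ.rangeRestrict_surjective, h1.symm⟩
    exact φ.rangeRestrict_injective_iff.1 h2.1
  have hone : ∀ a ∈ A, g * a = a * g → a = 1 := by
    intro a ha h
    have : (⟨a, ha⟩ : A) = 1 := hinj (by
      rw [map_one]; exact commutatorElement_eq_one_iff_mul_comm.2 h)
    simpa using congrArg Subtype.val this
  refine ⟨⟨centralizer {g}, ?_, ?_⟩, ?_⟩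
  · rw [eq_bot_iff]
    rintro a ⟨ha, hac⟩
    exact hone a ha (mem_centralizer_iff.1 hac g rfl)
  · rw [eq_top_iff]
    rintro x -
    -- Surjectivity matches `⁅g, x⁆` with some `⁅g, a⁆`; then `a⁻¹ * x` centralizes `g`.
    obtain ⟨a, ha⟩ : ⁅g, x⁆ ∈ φ.range := by rw [hr]; exact hg x
    have ha' : ⁅g, (a : G)⁆ = ⁅g, x⁆ := ha
    have : x = a * ((a : G)⁻¹ * x) := by group
    rw [this]
    refine mul_mem_sup a.2 (mem_centralizer_iff.2 ?_)
    rintro _ rfl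
    rw [← commutatorElement_eq_one_iff_mul_comm, commutatorElement_mul_right_eq_mul_conj, ← ha',
      commutatorElement_def, commutatorElement_def]
    group
  · rw [eq_bot_iff]
    rintro a ⟨ha, hac⟩
    exact hone a ha (mem_center_iff.1 hac g)

/-- An abelian nilpotent residual of a finite group has a complement and contains no nontrivial
central element. -/
theorem IsNilpotentResidual.splitsCentrally [Finite G] {A : Subgroup G}
    (hA : IsNilpotentResidual A) (hcomm : ∀ a ∈ A, ∀ b ∈ A, a * b = b * a) :
    SplitsCentrally A := by
  induction hcard : Nat.card G using Nat.strong_induction_on generalizing G with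
  | _ n ih =>
  have IH : ∀ {H : Type u} [Group H] [Finite H] {B : Subgroup H}, Nat.card H < Nat.card G →
      IsNilpotentResidual B → (∀ a ∈ B, ∀ b ∈ B, a * b = b * a) → SplitsCentrally B :=
    fun h hB hc => ih _ (hcard ▸ h) hB hc rfl
  have hn := hA.normal
  have IHq : ∀ (N : Subgroup G) [N.Normal], N ≠ ⊥ →
      SplitsCentrally (A.map (QuotientGroup.mk' N)) := by
    intro N _ hN
    refine IH (card_quotient_lt_of_ne_bot hN) (hA.map _ (QuotientGroup.mk'_surjective N)) ?_
    rintro _ ⟨a, ha, rfl⟩ _ ⟨b, hb, rfl⟩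
    rw [← map_mul, ← map_mul, hcomm a ha b hb]
  by_contra hns
  -- A proper nontrivial image `B` would satisfy `⁅B, G⁆ = B`, and induction in `G ⧸ B` and in a
  -- proper subgroup would split `A`.
  have endo : ∀ φ : A →* G, (∀ a, φ a ∈ A) →
      (∀ (x : G) (a b : A), (b : G) = x * a * x⁻¹ → φ b = x * φ a * x⁻¹) →
      φ.range ≠ A → φ.range = ⊥ := by
    intro φ hφA hφ hne
    by_contra hbot
    have hB := hA.commutator_range_eq φ hφ
    have : φ.range.Normal := commutator_top_right_le_iff.1 hB.le
    have hle : φ.range ≤ A := by rintro _ ⟨a, rfl⟩; exact hφA a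
    refine hns (SplitsCentrally.of_le hA hcomm hle hB (IHq _ hbot) fun E h1 h2 hE => ?_)
    refine IH (card_lt_of_ne_top fun h => hne ?_) hE ?_
    · rw [← h1, h, inf_top_eq]
    · exact fun a ha b hb => Subtype.ext (hcomm a (hle ha) b (hle hb))
  have hcent : ∀ g : G, (∀ x : G, ⁅g, x⁆ ∈ A) → ∀ a ∈ A, ⁅g, a⁆ = 1 := by
    intro g hg a ha
    have := endo (commutatorHom A hn hcomm g) (fun a => hg (a : G)) ?_
      (fun h => hns (SplitsCentrally.of_commutatorHom_range hn hcomm hg h))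
    · have h1 : commutatorHom A hn hcomm g ⟨a, ha⟩ ∈ (⊥ : Subgroup G) := this ▸ ⟨_, rfl⟩
      exact mem_bot.1 h1
    · intro x a b hb
      change ⁅g, (b : G)⁆ = x * ⁅g, (a : G)⁆ * x⁻¹
      -- Equivariance: conjugating `g` by `x` changes it only by `⁅x, g⁆ ∈ A`, which acts trivially
      -- on `A`.
      have hc : ⁅x, g⁆ ∈ A := by rw [← commutatorElement_inv]; exact A.inv_mem (hg x)
      rw [conjugate_commutatorElement, ← hb]
      have : x * g * x⁻¹ = ⁅x, g⁆ * g := by rw [commutatorElement_def]; group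
      rw [this, commutatorElement_mul_left_eq_conj_mul, hcomm _ hc _ (hg b),
        commutatorElement_eq_one_iff_mul_comm.2 (hcomm _ hc b b.2)]
      group
  have hA1 : A ≠ ⊥ := by
    rintro rfl
    exact hns ⟨⟨⊤, by simp, by simp⟩, by simp⟩
  obtain ⟨p, hp, hpA⟩ := Nat.exists_prime_and_dvd
    ((one_lt_card_iff_ne_bot A).2 hA1).ne'
  have := Fact.mk hp
  -- The `p`-th power map kills an element of order `p`, so it is not onto and must be trivial.
  have hexp : ∀ a ∈ A, a ^ p = 1 := by
    obtain ⟨a₀, ha₀⟩ := exists_prime_orderOf_dvd_card' p hpA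
    let φ : A →* G :=
      { toFun := fun a => (a : G) ^ p
        map_one' := by simp
        map_mul' := fun a b => (show Commute (a : G) b from hcomm a a.2 b b.2).mul_pow p }
    have h1 : φ a₀ = 1 := by
      change (a₀ : G) ^ p = 1
      rw [← ha₀, ← Subgroup.orderOf_coe, pow_orderOf_eq_one]
    have hr : φ.range = ⊥ := by
      refine endo φ (fun a => A.pow_mem a.2 p) ?_ fun h => ?_
      · intro x a b hb
        change (b : G) ^ p = x * (a : G) ^ p * x⁻¹
        rw [hb, conj_pow]
      · have h2 : Function.Injective φ := by
          have h1 : Nat.card φ.range = Nat.card A := by rw [h]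
          have h2 : Function.Bijective φ.rangeRestrict :=
            (Nat.bijective_iff_surjective_and_card _).2 ⟨φ.rangeRestrict_surjective, h1.symm⟩
          exact φ.rangeRestrict_injective_iff.1 h2.1
        have h3 : a₀ = 1 := h2 (h1.trans φ.map_one.symm)
        rw [h3, orderOf_one] at ha₀
        exact hp.one_lt.ne ha₀
    intro a ha
    have : φ ⟨a, ha⟩ ∈ (⊥ : Subgroup G) := hr ▸ ⟨_, rfl⟩
    exact mem_bot.1 this
  by_cases hG : IsPGroup p G
  · have := hG.isNilpotent
    obtain ⟨k, hk⟩ := Subgroup.nilpotent_iff_lowerCentralSeries.1 this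
    exact hA1 (eq_bot_iff.2 (hk ▸ hA.le_lowerCentralSeries k))
  obtain ⟨q, hq, hqp, hqG⟩ : ∃ q, q.Prime ∧ q ≠ p ∧ q ∣ Nat.card G := by
    by_contra! h
    refine hG (IsPGroup.of_card (n := (Nat.card G).primeFactorsList.length)
      (Nat.eq_prime_pow_of_unique_prime_dvd Nat.card_pos.ne' fun {d} hd hdG => ?_))
    by_contra hne
    exact h d hd hne hdG
  have hqQ : q ∣ Nat.card (G ⧸ A) := by
    rw [card_eq_card_quotient_mul_card_subgroup A] at hqG
    refine (hq.dvd_mul.1 hqG).resolve_right fun h => hqp ?_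
    have := Fact.mk hq
    obtain ⟨a, ha⟩ := exists_prime_orderOf_dvd_card' q h
    have : orderOf a ∣ p := orderOf_dvd_of_pow_eq_one (Subtype.ext (by simpa using hexp a a.2))
    rw [ha] at this
    exact (Nat.prime_dvd_prime_iff_eq hq hp).1 this
  have := hA.isNilpotent_quotient
  obtain ⟨gq, hgc, hgo⟩ := Group.IsNilpotent.exists_mem_center_orderOf_eq hq hqQ
  obtain ⟨g, rfl⟩ := QuotientGroup.mk'_surjective A gq
  have hgA : ∀ x, ⁅g, x⁆ ∈ A := by
    intro x
    rw [← QuotientGroup.eq_one_iff, ← QuotientGroup.mk'_apply, map_commutatorElement,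
      commutatorElement_eq_one_iff_mul_comm]
    exact (mem_center_iff.1 hgc _).symm
  have hgq : g ^ q ∈ A := by
    rw [← QuotientGroup.eq_one_iff, ← QuotientGroup.mk'_apply, map_pow, ← hgo, pow_orderOf_eq_one]
  have hcop : Nat.Coprime p q := (Nat.coprime_primes hp hq).2 hqp.symm
  have hA_one : ∀ a ∈ A, a ^ q = 1 → a = 1 := fun a ha h => by
    rw [← orderOf_eq_one_iff]
    exact Nat.eq_one_of_dvd_coprimes hcop (orderOf_dvd_of_pow_eq_one (hexp a ha))
      (orderOf_dvd_of_pow_eq_one h)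
  -- The `p`-th power removes the `A`-part of `g`: `h ^ q = 1`, while `h ≠ 1` since `p` is prime to
  -- `q`.
  set h := g ^ p with hh
  have hhq : h ^ q = 1 := by rw [hh, ← pow_mul, mul_comm, pow_mul]; exact hexp _ hgq
  have hhA : ∀ x, ⁅h, x⁆ ∈ A := by
    intro x
    rw [← QuotientGroup.eq_one_iff, ← QuotientGroup.mk'_apply, map_commutatorElement,
      commutatorElement_eq_one_iff_mul_comm, hh]
    exact (mem_center_iff.1 ((center _).pow_mem hgc p) _).symm
  have hhZ : ∀ x, h * x = x * h := by
    intro x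
    rw [← commutatorElement_eq_one_iff_mul_comm, ← inv_eq_one, commutatorElement_inv]
    have hxA : ⁅x, h⁆ ∈ A := by rw [← commutatorElement_inv]; exact A.inv_mem (hhA x)
    apply hA_one _ hxA
    have hc : Commute ⁅x, h⁆ h :=
      (commutatorElement_eq_one_iff_commute.1 (hcent h hhA _ hxA)).symm
    -- The product is the conjugate `x * h * x⁻¹`, and its factors commute, so `⁅x, h⁆ ^ q = 1`; but
    -- `A` has no `q`-torsion.
    have h1 : (⁅x, h⁆ * h) ^ q = 1 := by
      rw [commutatorElement_def, inv_mul_cancel_right, conj_pow, hhq]; simp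
    rwa [hc.mul_pow, hhq, mul_one] at h1
  have hN : (zpowers h).Normal := by
    refine ⟨fun y hy x => ?_⟩
    obtain ⟨k, rfl⟩ := mem_zpowers_iff.1 hy
    rw [← (show Commute h x from hhZ x).zpow_left k |>.eq, mul_inv_cancel_right]
    exact hy
  refine hns (SplitsCentrally.of_disjoint (N := zpowers h) ?_ (IHq _ ?_))
  · rw [eq_bot_iff]
    rintro y ⟨hyA, hy⟩
    obtain ⟨k, rfl⟩ := mem_zpowers_iff.1 hy
    refine hA_one _ hyA ?_
    rw [← zpow_natCast, ← zpow_mul, mul_comm, zpow_mul, zpow_natCast, hhq, one_zpow]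
  · rw [Ne, zpowers_eq_bot]
    intro h1
    have h2 : (QuotientGroup.mk' A g) ^ p = 1 := by rw [← map_pow, ← hh, h1, map_one]
    have h3 := orderOf_dvd_of_pow_eq_one h2
    rw [hgo] at h3
    exact hqp ((Nat.prime_dvd_prime_iff_eq hq hp).1 h3)

end Splitting

/-! ### Class-two `p`-groups with a cyclic subgroup of index `p` -/

section ClassTwo

variable {S : Type*} [Group S]

theorem pow_mul_comm_of_commute_commutator {u v : S} (hv : Commute ⁅v, u⁆ v) (hu : Commute ⁅v, u⁆ u)
    (n : ℕ) : v ^ n * u = u * v ^ n * ⁅v, u⁆ ^ n := by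
  have h1 : v * u = u * v * ⁅v, u⁆ := by
    rw [← (hu.mul_right hv).eq, commutatorElement_def]; group
  induction n with
  | zero => simp
  | succ n ih =>
    calc v ^ (n + 1) * u = v ^ n * (v * u) := by rw [pow_succ, mul_assoc]
      _ = (v ^ n * u) * v * ⁅v, u⁆ := by rw [h1]; simp only [mul_assoc]
      _ = u * v ^ n * (⁅v, u⁆ ^ n * v) * ⁅v, u⁆ := by rw [ih]; simp only [mul_assoc]
      _ = u * v ^ (n + 1) * ⁅v, u⁆ ^ (n + 1) := by
        rw [(hv.pow_left n).eq, pow_succ, pow_succ]; simp only [mul_assoc]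

/-- Collecting the factors `u` to the left costs `0 + 1 + ⋯ + (n - 1)` copies of `⁅v, u⁆`. For `n =
p` odd this number is divisible by `p`, which makes the `p`-th power map multiplicative below. -/
theorem mul_pow_of_commute_commutator {u v : S} (hv : Commute ⁅v, u⁆ v) (hu : Commute ⁅v, u⁆ u)
    (n : ℕ) : (u * v) ^ n = u ^ n * v ^ n * ⁅v, u⁆ ^ (n * (n - 1) / 2) := by
  rw [← Finset.sum_range_id]
  induction n with
  | zero => simp
  | succ n ih =>
    set T := ∑ i ∈ Finset.range n, i with hT
    have hc : Commute (⁅v, u⁆ ^ T) (u * v) := (hu.mul_right hv).pow_left T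
    have hcn : Commute (⁅v, u⁆ ^ n) v := hv.pow_left n
    calc (u * v) ^ (n + 1) = u ^ n * v ^ n * (⁅v, u⁆ ^ T * (u * v)) := by
          rw [pow_succ, ih]; simp only [mul_assoc]
      _ = u ^ n * (v ^ n * u) * v * ⁅v, u⁆ ^ T := by rw [hc.eq]; simp only [mul_assoc]
      _ = u ^ n * u * v ^ n * (⁅v, u⁆ ^ n * v) * ⁅v, u⁆ ^ T := by
        rw [pow_mul_comm_of_commute_commutator hv hu]; simp only [mul_assoc]
      _ = _ := by
        rw [hcn.eq, Finset.sum_range_succ, ← hT, add_comm T n, pow_succ u n, pow_succ v n,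
          pow_add ⁅v, u⁆ n T]
        simp only [mul_assoc]

end ClassTwo

/-- In a nonabelian `p`-group of class two, `p` odd, with commutators of exponent `p` and a cyclic
subgroup of index at most `p`, some element outside the centre is fixed modulo the derived subgroup
by all automorphisms. -/
theorem exists_not_commute_forall_mulEquiv_div_mem {S : Type*} [Group S] [Finite S] {p : ℕ}
    (hp : p.Prime) (hp2 : p ≠ 2) (hS : IsPGroup p S)
    (hcl : ∀ a b c : S, Commute ⁅a, b⁆ c) (hexp : ∀ a b : S, ⁅a, b⁆ ^ p = 1)
    {x : S} (hx : Nat.card S ≤ p * orderOf x) (hna : ¬ ∀ a b : S, Commute a b) :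
    ∃ y : S, (∃ u, ¬ Commute u y) ∧ ∀ σ : S ≃* S, σ y * y⁻¹ ∈ commutator S := by
  have := Fact.mk hp
  have hpow : ∀ u v : S, (u * v) ^ p = u ^ p * v ^ p := by
    intro u v
    rw [mul_pow_of_commute_commutator (hcl _ _ _) (hcl _ _ _)]
    have h2 : p * (p - 1) / 2 = p * ((p - 1) / 2) := by
      apply Nat.mul_div_assoc
      exact (Nat.Prime.even_sub_one hp hp2).two_dvd
    rw [h2, pow_mul, hexp, one_pow, mul_one]
  obtain ⟨s, hs⟩ := hS.exists_orderOf_eq_pow x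
  have hpx : ∀ n : ℕ, ¬ p ∣ n → x ∈ Submonoid.powers (x ^ n) := by
    intro n hn
    obtain ⟨m, hm⟩ := exists_pow_eq_self_of_coprime (x := x) (n := n)
      (by rw [hs]; exact ((hp.coprime_iff_not_dvd).2 hn).symm.pow_right s)
    exact ⟨m, hm⟩
  set X := zpowers x with hX
  have hXpow : ∀ u ∈ X, ∃ n : ℕ, x ^ n = u := fun u hu => mem_powers_iff_mem_zpowers.2 hu
  have hXi : X.index = p := by
    have h1 : orderOf x * X.index = Nat.card S := by
      rw [← X.card_mul_index, hX, Nat.card_zpowers]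
    have h2 : X.index ≤ p := by
      have : orderOf x * X.index ≤ orderOf x * p := by rw [h1, mul_comm _ p]; exact hx
      exact Nat.le_of_mul_le_mul_left this (orderOf_pos x)
    obtain ⟨k, hk⟩ := hS.index X
    rcases k with _ | _ | k
    · refine absurd (fun a b => ?_) hna
      have ht : X = ⊤ := index_eq_one.1 (by simpa using hk)
      obtain ⟨i, rfl⟩ := hXpow a (ht ▸ mem_top a)
      obtain ⟨j, rfl⟩ := hXpow b (ht ▸ mem_top b)
      exact Commute.pow_pow_self x i j
    · simpa using hk
    · rw [hk] at h2
      have : p ^ 1 < p ^ (k + 1 + 1) := Nat.pow_lt_pow_right hp.one_lt (by omega)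
      exact absurd this (not_lt.2 (by rwa [pow_one]))
  have hXn : X.Normal := by
    apply normal_of_index_eq_minFac_card
    obtain ⟨n, hn⟩ := hS.exists_card_eq
    rw [hXi, hn, hp.pow_minFac]
    rintro rfl
    have := X.index_dvd_card
    rw [hXi, hn, pow_zero, Nat.dvd_one] at this
    exact hp.ne_one this
  have hcardQ : Nat.card (S ⧸ X) = p := hXi
  have hgen : ∀ y ∉ X, ∀ u : S, ∃ i k : ℕ, u = x ^ i * y ^ k := by
    intro y hy u
    have h1 : (QuotientGroup.mk' X y) ≠ 1 := fun h => hy ((QuotientGroup.eq_one_iff y).1 h)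
    obtain ⟨k, hk⟩ := mem_powers_of_prime_card (g' := QuotientGroup.mk' X u) hcardQ h1
    have h2 : u * (y ^ k)⁻¹ ∈ X := by
      rw [← QuotientGroup.eq_one_iff, ← QuotientGroup.mk'_apply, map_mul, map_inv, map_pow]
      exact mul_inv_eq_one.2 hk.symm
    obtain ⟨i, hi⟩ := hXpow _ h2
    exact ⟨i, k, by rw [hi]; group⟩
  have hxy : ∀ y ∉ X, ¬ Commute x y := by
    intro y hy h
    refine hna fun a b => ?_
    obtain ⟨i, k, rfl⟩ := hgen y hy a
    obtain ⟨j, l, rfl⟩ := hgen y hy b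
    exact (((Commute.refl x).pow_pow i j).mul_right (h.pow_pow i l)).mul_left
      ((h.symm.pow_pow k j).mul_right ((Commute.refl y).pow_pow k l))
  obtain ⟨y, hyX, hyp⟩ : ∃ y ∉ X, y ^ p = 1 := by
    obtain ⟨y, hy⟩ : ∃ y, y ∉ X := by
      by_contra! h
      have : X = ⊤ := eq_top_iff.2 fun y _ => h y
      rw [this, index_top] at hXi
      exact hp.ne_one hXi.symm
    have h1 : y ^ p ∈ X := by
      rw [← QuotientGroup.eq_one_iff, ← QuotientGroup.mk'_apply, map_pow, ← hcardQ]
      exact pow_card_eq_one'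
    obtain ⟨j, hj⟩ := hXpow _ h1
    -- Otherwise `x` would be a power of `y ^ p` and commute with `y`. Hence `y ^ p` is the `p`-th
    -- power of some `x ^ i`, and `(x ^ i)⁻¹ * y` has `p`-th power `1`.
    have hpj : p ∣ j := by
      by_contra h
      obtain ⟨m, hm⟩ := hpx j h
      refine hxy y hy ?_
      have : x = y ^ (p * m) := by rw [pow_mul, ← hj]; exact hm.symm
      rw [this]
      exact (Commute.refl y).pow_left _
    obtain ⟨i, rfl⟩ := hpj
    refine ⟨(x ^ i)⁻¹ * y, fun h => hy ?_, ?_⟩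
    · have := X.mul_mem (X.pow_mem (mem_zpowers x) i) h
      rwa [mul_inv_cancel_left] at this
    · rw [hpow, ← hj, inv_pow, ← pow_mul, mul_comm i p, inv_mul_cancel]
  set z := ⁅x, y⁆ with hz
  have hz1 : z ≠ 1 := fun h => hxy y hyX (commutatorElement_eq_one_iff_commute.1 h)
  have hzp : z ^ p = 1 := hexp x y
  have hzo : orderOf z = p := orderOf_eq_prime hzp hz1
  have hzX : z ∈ X := by
    rw [hz, commutatorElement_def, mul_assoc, mul_assoc]
    refine X.mul_mem (mem_zpowers x) ?_
    rw [← mul_assoc]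
    exact hXn.conj_mem _ (X.inv_mem (mem_zpowers x)) y
  obtain ⟨l, hl⟩ := hXpow z hzX
  have hpl : p ∣ l := by
    by_contra h
    obtain ⟨m, hm⟩ := hpx l h
    refine hxy y hyX ?_
    have : x = z ^ m := by rw [← hl]; exact hm.symm
    rw [this]
    exact (hcl x y y).pow_left m
  -- The cyclic `p`-group `X` has a single subgroup of order `p`, namely `zpowers z`.
  have hXz : ∀ i : ℕ, (x ^ i) ^ p = 1 → x ^ i ∈ zpowers z := by
    intro i hi
    rcases s with _ | s
    · rw [pow_zero, orderOf_eq_one_iff] at hs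
      exact absurd (by rw [← hl, hs, one_pow]) hz1
    have hdiv : ∀ k, (x ^ k) ^ p = 1 → p ^ s ∣ k := by
      intro k hk
      rw [← pow_mul] at hk
      have := orderOf_dvd_of_pow_eq_one hk
      rw [hs, pow_succ] at this
      exact Nat.dvd_of_mul_dvd_mul_right hp.pos this
    obtain ⟨i', rfl⟩ := hdiv i hi
    obtain ⟨l', hl'⟩ := hdiv l (by rw [hl, hzp])
    have ht : (x ^ p ^ s) ^ p = 1 := by rw [← pow_mul, ← pow_succ, ← hs, pow_orderOf_eq_one]
    have hcop : Nat.Coprime l' (orderOf (x ^ p ^ s)) := by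
      refine Nat.Coprime.coprime_dvd_right (orderOf_dvd_of_pow_eq_one ht) ?_
      rw [Nat.coprime_comm, hp.coprime_iff_not_dvd]
      rintro ⟨c, rfl⟩
      refine hz1 ?_
      rw [← hl, hl', pow_mul, pow_mul, ht, one_pow]
    obtain ⟨m, hm⟩ := exists_pow_eq_self_of_coprime hcop
    rw [pow_mul, ← hm, ← pow_mul x, ← hl', hl]
    exact pow_mem (pow_mem (mem_zpowers z) m) i'
  have hzc : zpowers z ≤ commutator S := by
    rw [zpowers_le, _root_.commutator_def]
    exact commutator_mem_commutator (mem_top x) (mem_top y)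
  have hcomm_pow : ∀ a b : ℕ, ⁅x ^ a, y ^ b⁆ = z ^ (a * b) := by
    have h1 : ∀ (u v : S) (n : ℕ), ⁅u ^ n, v⁆ = ⁅u, v⁆ ^ n := by
      intro u v n
      rw [commutatorElement_def, pow_mul_comm_of_commute_commutator (hcl _ _ _) (hcl _ _ _),
        ← ((hcl u v (v * u ^ n)).pow_left n).eq]
      group
    have h2 : ∀ (u v : S) (n : ℕ), ⁅u, v ^ n⁆ = ⁅u, v⁆ ^ n := by
      intro u v n
      rw [← commutatorElement_inv, h1, ← inv_pow, commutatorElement_inv]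
    intro a b
    rw [h1, h2, ← pow_mul, mul_comm]
  refine ⟨y, ⟨x, hxy y hyX⟩, fun σ => ?_⟩
  obtain ⟨a, b, hσx⟩ := hgen y hyX (σ x)
  obtain ⟨i, m, hσy⟩ := hgen y hyX (σ y)
  have hi : x ^ i ∈ zpowers z := by
    refine hXz i ?_
    have h1 : (σ y) ^ p = 1 := by rw [← map_pow, hyp, map_one]
    rwa [hσy, hpow, ← pow_mul y, mul_comm m p, pow_mul y, hyp, one_pow, mul_one] at h1
  have hic : ∀ c, Commute (x ^ i) c := by
    intro c
    obtain ⟨k, hk⟩ := mem_zpowers_iff.1 hi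
    rw [← hk]
    exact (hcl x y c).zpow_left k
  -- `σ z` is computed twice: as a commutator it is `z ^ (a * m)`; from `z = x ^ l` with `p ∣ l` it
  -- is `z ^ a`. Hence `m ≡ 1` modulo `p`.
  have hσz : σ z = z ^ (a * m) := by
    have h1 : ⁅x ^ a * y ^ b, y ^ m⁆ = ⁅x ^ a, y ^ m⁆ := by
      rw [commutatorElement_mul_left_eq_conj_mul,
        commutatorElement_eq_one_iff_commute.2 (Commute.pow_pow_self y b m)]
      simp
    rw [hz, map_commutatorElement, hσx, hσy, ← hcomm_pow, ← h1,
      commutatorElement_mul_right_eq_mul_conj, commutatorElement_eq_one_iff_commute.2 (hic _).symm,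
      one_mul, (hic _).eq, mul_inv_cancel_right]
  have hσz' : σ z = z ^ a := by
    obtain ⟨l', rfl⟩ := hpl
    rw [← hl, map_pow, hσx, pow_mul, hpow, ← pow_mul y, mul_comm b p, pow_mul y, hyp, one_pow,
      mul_one, ← pow_mul, ← pow_mul, ← pow_mul]
    congr 1; ring
  have hpa : ¬ p ∣ a := by
    rintro ⟨c, rfl⟩
    rw [pow_mul, hzp, one_pow] at hσz'
    exact hz1 ((map_eq_one_iff σ σ.injective).1 hσz')
  have hm : m ≡ 1 [MOD p] := by
    have h1 : a * m ≡ a * 1 [MOD p] := by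
      rw [mul_one, ← hzo, ← pow_eq_pow_iff_modEq, ← hσz, hσz']
    exact Nat.ModEq.cancel_left_of_coprime ((hp.coprime_iff_not_dvd).2 hpa) h1
  have hym : y ^ m = y := by
    have hyo : orderOf y = p := orderOf_eq_prime hyp fun h => hyX (h ▸ X.one_mem)
    conv_rhs => rw [← pow_one y]
    rwa [pow_eq_pow_iff_modEq, hyo]
  rw [hσy, hym, mul_inv_cancel_right]
  exact hzc hi

/-! ### Two-dimensional representations in odd order -/

/-- Commuting traceless `2 × 2` matrices are proportional. -/
theorem Matrix.exists_eq_smul_of_commute_of_trace_eq_zero {F : Type*} [Field F] (h2 : (2 : F) ≠ 0)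
    {X Y : Matrix (Fin 2) (Fin 2) F} (hX : X.trace = 0) (hY : Y.trace = 0) (hXY : Commute X Y)
    (hX0 : X ≠ 0) : ∃ t : F, Y = t • X := by
  rw [trace_fin_two] at hX hY
  have hx : X 1 1 = - X 0 0 := by linear_combination hX
  have hy : Y 1 1 = - Y 0 0 := by linear_combination hY
  have h00 := congrFun (congrFun hXY.eq 0) 0
  have h01 := congrFun (congrFun hXY.eq 0) 1
  have h10 := congrFun (congrFun hXY.eq 1) 0
  simp only [mul_apply, Fin.sum_univ_two, hx, hy] at h00 h01 h10
  -- The coordinate vectors of `X` and `Y` have vanishing `2 × 2` minors; any nonzero coordinate of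
  -- `X` then gives the ratio.
  have e1 : X 0 1 * Y 1 0 = Y 0 1 * X 1 0 := by linear_combination h00
  have e2 : X 0 0 * Y 0 1 = Y 0 0 * X 0 1 := by
    apply mul_left_cancel₀ h2; linear_combination h01
  have e3 : X 0 0 * Y 1 0 = Y 0 0 * X 1 0 := by
    apply mul_left_cancel₀ h2; linear_combination -h10
  by_cases c0 : X 0 0 = 0
  · by_cases c1 : X 0 1 = 0
    · by_cases c2 : X 1 0 = 0
      · refine absurd ?_ hX0
        ext i j; fin_cases i <;> fin_cases j <;> simp [c0, c1, c2, hx]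
      · refine ⟨Y 1 0 / X 1 0, ?_⟩
        ext i j; fin_cases i <;> fin_cases j <;> simp [hx, hy] <;> field_simp <;> grind
    · refine ⟨Y 0 1 / X 0 1, ?_⟩
      ext i j; fin_cases i <;> fin_cases j <;> simp [hx, hy] <;> field_simp <;> grind
  · refine ⟨Y 0 0 / X 0 0, ?_⟩
    ext i j; fin_cases i <;> fin_cases j <;> simp [hx, hy] <;> field_simp <;> grind

/-- In a two-dimensional representation of a group of odd order, an element commuting with its
conjugates is central in the image, or the representation is reducible. -/
theorem commute_or_exists_invariant_submodule {F V K : Type*} [Field F] (h2 : (2 : F) ≠ 0)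
    [AddCommGroup V] [Module F V] (hV : Module.finrank F V = 2) [Group K] [Finite K]
    (hK : Odd (Nat.card K)) (ρ : K →* Module.End F V) {a : K}
    (ha : ∀ k, Commute (ρ a) (ρ (k * a * k⁻¹))) :
    (∀ k, Commute (ρ k) (ρ a)) ∨
      ∃ W : Submodule F V, W ≠ ⊥ ∧ W ≠ ⊤ ∧ ∀ k, ∀ v ∈ W, ρ k v ∈ W := by
  have : FiniteDimensional F V := Module.finite_of_finrank_eq_succ hV
  let b := Module.finBasisOfFinrankEq F V hV
  let e := LinearMap.toMatrixAlgEquiv b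
  set c := (e (ρ a)).trace / 2 with hc
  set T : Module.End F V := ρ a - c • 1 with hT
  have hconj : ∀ k, ρ (k * a * k⁻¹) - c • 1 = ρ k * T * ρ k⁻¹ := by
    intro k
    have h1 : ρ k * ρ k⁻¹ = 1 := by rw [← map_mul, mul_inv_cancel, map_one]
    rw [hT, mul_sub, sub_mul, map_mul, map_mul, mul_smul_comm, smul_mul_assoc, mul_one, h1]
  by_cases hT0 : T = 0
  · left
    intro k
    rw [sub_eq_zero.1 hT0]
    exact (Commute.one_right _).smul_right c
  have htr : ∀ S : Module.End F V, (e S).trace = (e (ρ a)).trace → (e (S - c • 1)).trace = 0 := by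
    intro S hS
    rw [map_sub, map_smul, map_one, Matrix.trace_sub, Matrix.trace_smul, Matrix.trace_one, hS, hc]
    simp only [Fintype.card_fin, smul_eq_mul]
    field_simp
    norm_num
  -- The conjugate of `T` by `ρ k` is traceless and commutes with `T`, hence is a multiple of it.
  have hprop : ∀ k, ∃ t : F, ρ k * T = t • (T * ρ k) := by
    intro k
    have h1 : ρ k⁻¹ * ρ k = 1 := by rw [← map_mul, inv_mul_cancel, map_one]
    have htr' : (e (ρ (k * a * k⁻¹))).trace = (e (ρ a)).trace := by
      rw [map_mul, map_mul, map_mul, map_mul, Matrix.trace_mul_comm, ← mul_assoc, ← map_mul, h1,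
        map_one, one_mul]
    have hcom : Commute T (ρ (k * a * k⁻¹) - c • 1) :=
      ((ha k).sub_right ((Commute.one_right _).smul_right c)).sub_left
        ((Commute.one_left _).smul_left c)
    obtain ⟨t, ht⟩ := Matrix.exists_eq_smul_of_commute_of_trace_eq_zero h2 (htr _ rfl)
      (htr _ htr') (hcom.map e) ((map_ne_zero_iff e e.injective).2 hT0)
    refine ⟨t, ?_⟩
    rw [← map_smul, e.injective.eq_iff, hconj] at ht
    calc ρ k * T = ρ k * T * (ρ k⁻¹ * ρ k) := by rw [h1, mul_one]
      _ = t • (T * ρ k) := by rw [← mul_assoc, ht, smul_mul_assoc]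
  choose t ht using hprop
  have htodd : ∀ k, t k ^ orderOf k = 1 := by
    intro k
    have h1 : ∀ n : ℕ, ρ k ^ n * T = t k ^ n • (T * ρ k ^ n) := by
      intro n
      induction n with
      | zero => simp
      | succ n ih =>
        rw [pow_succ, mul_assoc, ht, mul_smul_comm, ← mul_assoc, ih, smul_mul_assoc, mul_assoc,
          smul_smul, ← pow_succ, mul_comm, ← pow_succ]
    have h3 := h1 (orderOf k)
    rw [← map_pow, pow_orderOf_eq_one, map_one, one_mul, mul_one] at h3
    by_contra h
    have : (1 - t k ^ orderOf k) • T = 0 := by rw [sub_smul, one_smul, ← h3, sub_self]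
    rcases smul_eq_zero.1 this with h4 | h4
    · exact h (sub_eq_zero.1 h4).symm
    · exact hT0 h4
  have hodd : ∀ k : K, Odd (orderOf k) := fun k => hK.of_dvd_nat (orderOf_dvd_natCard k)
  by_cases hdet : LinearMap.det T = 0
  · right
    refine ⟨LinearMap.ker T, (LinearMap.bot_lt_ker_of_det_eq_zero hdet).ne', ?_, ?_⟩
    · rwa [Ne, LinearMap.ker_eq_top]
    · intro k v hv
      have h1 := LinearMap.congr_fun (ht k) v
      rw [LinearMap.smul_apply, Module.End.mul_apply, Module.End.mul_apply, LinearMap.mem_ker.1 hv,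
        map_zero] at h1
      rcases smul_eq_zero.1 h1.symm with h3 | h3
      · have := htodd k
        rw [h3, zero_pow (orderOf_pos k).ne'] at this
        exact absurd this zero_ne_one
      · exact h3
  · left
    intro k
    -- Compare determinants in dimension two. As `t k` also has odd order, it equals `1`.
    have h1 : t k ^ 2 = 1 := by
      have h3 := congrArg LinearMap.det (ht k)
      rw [map_mul, LinearMap.det_smul, map_mul, hV, mul_comm (LinearMap.det T)] at h3
      have h4 : LinearMap.det (ρ k) ≠ 0 := by
        have : LinearMap.det (ρ k) * LinearMap.det (ρ k⁻¹) = 1 := by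
          rw [← map_mul, ← map_mul, mul_inv_cancel, map_one, map_one]
        exact left_ne_zero_of_mul_eq_one this
      exact (mul_eq_right₀ (mul_ne_zero h4 hdet)).1 h3.symm
    have h3 : t k = 1 := by
      obtain ⟨n, hn⟩ := hodd k
      have := htodd k
      rwa [hn, pow_succ, pow_mul, h1, one_pow, one_mul] at this
    have h4 : Commute (ρ k) T := by
      have := ht k
      rwa [h3, one_smul] at this
    have : ρ a = T + c • 1 := by rw [hT]; abel
    rw [this]
    exact h4.add_right ((Commute.one_right _).smul_right c)

/-- The automorphisms of an abelian group of exponent `p` as linear maps. -/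
def mulAutZModRep (C : Type*) [CommGroup C] (p : ℕ) [Module (ZMod p) (Additive C)] :
    MulAut C →* Module.End (ZMod p) (Additive C) where
  toFun f := (MonoidHom.toAdditive f.toMonoidHom).toZModLinearMap p
  map_one' := rfl
  map_mul' _ _ := rfl

theorem mulAutZModRep_apply {C : Type*} [CommGroup C] (p : ℕ) [Module (ZMod p) (Additive C)]
    (f : MulAut C) (v : Additive C) : mulAutZModRep C p f v = Additive.ofMul (f v.toMul) := rfl

theorem IsCyclic.mulAut_commute {C : Type*} [Group C] [IsCyclic C] (f g : MulAut C) :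
    Commute f g := by
  apply (IsCyclic.mulAutMulEquiv C).injective
  rw [map_mul, map_mul, mul_comm]

/-- A nilpotent residual acts trivially on a minimal normal subgroup of order at most `p ^ 2` on
which it induces an abelian group, provided the order of the group is odd. -/
theorem IsNilpotentResidual.commute_of_card_le_sq {G : Type*} [Group G] [Finite G]
    (hodd : Odd (Nat.card G)) {R : Subgroup G} (hR : IsNilpotentResidual R) {N : Subgroup G}
    (hN : N.Normal) (hmin : ∀ M : Subgroup G, M.Normal → M ≤ N → M = ⊥ ∨ M = N)
    (hcomm : ∀ a ∈ N, ∀ b ∈ N, a * b = b * a) {p : ℕ} (hp : p.Prime) (hp2 : p ≠ 2)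
    (hexp : ∀ a ∈ N, a ^ p = 1) (hcard : Nat.card N ≤ p ^ 2)
    (hab : ∀ a ∈ R, ∀ b ∈ R, ∀ n ∈ N, Commute ⁅a, b⁆ n) :
    ∀ a ∈ R, ∀ n ∈ N, Commute a n := by
  have := Fact.mk hp
  let α : G →* MulAut N := MulAut.conjNormal
  have hker : ∀ g, α g = 1 ↔ ∀ n ∈ N, Commute g n := by
    intro g
    constructor
    · intro h n hn
      have h1 := congrArg Subtype.val (DFunLike.congr_fun h (⟨n, hn⟩ : N))
      have h2 : g * n * g⁻¹ = n := by simpa [α] using h1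
      exact mul_inv_eq_iff_eq_mul.1 h2
    · intro h
      ext n
      simp only [α, MulAut.conjNormal_apply, MulAut.one_apply]
      rw [(h n n.2).eq, mul_inv_cancel_right]
  -- If the image of `R` is central in that of `G`, then `R = ⁅R, G⁆` acts trivially.
  suffices h : ∀ a ∈ R, ∀ k, Commute (α k) (α a) by
    have hle : R ≤ α.ker := by
      conv_lhs => rw [← hR.commutator_eq]
      rw [commutator_le]
      intro a ha k _
      rw [MonoidHom.mem_ker, map_commutatorElement]
      exact commutatorElement_eq_one_iff_commute.2 (h a ha k).symm
    exact fun a ha => (hker a).1 (hle ha)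
  let : CommGroup N :=
    { (inferInstance : Group N) with mul_comm := fun a b => Subtype.ext (hcomm a a.2 b b.2) }
  let : Module (ZMod p) (Additive N) := AddCommGroup.zmodModule (n := p) fun v =>
    congrArg Additive.ofMul (Subtype.ext (hexp v.toMul v.toMul.2) : v.toMul ^ p = 1)
  have hcardV : Nat.card N = p ^ Module.finrank (ZMod p) (Additive N) := by
    have := Module.natCard_eq_pow_finrank (K := ZMod p) (V := Additive N)
    rwa [Nat.card_zmod] at this
  have hr : Module.finrank (ZMod p) (Additive N) ≤ 2 := by
    rw [hcardV] at hcard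
    exact (Nat.pow_le_pow_iff_right hp.one_lt).1 hcard
  rcases hr.lt_or_eq with hr | hr
  · have hcyc : IsCyclic N := by
      have : Module.finrank (ZMod p) (Additive N) = 0 ∨
        Module.finrank (ZMod p) (Additive N) = 1 := by omega
      rcases this with h | h
      · have : Subsingleton N := by
          rw [h, pow_zero] at hcardV
          exact (Nat.card_eq_one_iff_unique.1 hcardV).1
        infer_instance
      · rw [h, pow_one] at hcardV
        exact isCyclic_of_prime_card hcardV
    exact fun a _ k => IsCyclic.mulAut_commute _ _
  · intro a ha
    let ρ := (mulAutZModRep N p).comp α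
    have hρinj : ∀ f g : MulAut N, mulAutZModRep N p f = mulAutZModRep N p g → f = g := by
      intro f g h
      ext n
      exact congrArg (fun v => ((Additive.toMul v : N) : G))
        (LinearMap.congr_fun h (Additive.ofMul n))
    have h2 : (2 : ZMod p) ≠ 0 := by
      intro h
      have : (p : ℕ) ∣ 2 := (ZMod.natCast_eq_zero_iff 2 p).1 (by exact_mod_cast h)
      exact hp2 ((Nat.prime_dvd_prime_iff_eq hp Nat.prime_two).1 this)
    have hconj : ∀ k, Commute (ρ a) (ρ (k * a * k⁻¹)) := by
      intro k
      have h1 : Commute (α a) (α (k * a * k⁻¹)) := by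
        rw [← commutatorElement_eq_one_iff_commute, ← map_commutatorElement, hker]
        exact hab a ha _ (hR.normal.conj_mem a ha k)
      exact h1.map (mulAutZModRep N p)
    rcases commute_or_exists_invariant_submodule h2 hr hodd ρ hconj with h | ⟨W, hW0, hW1, hW⟩
    · intro k
      apply hρinj
      rw [map_mul, map_mul]
      exact h k
    -- An invariant line would be a normal subgroup of `G` strictly between `⊥` and `N`.
    · exfalso
      let L : Subgroup N := AddSubgroup.toSubgroup' W.toAddSubgroup
      have hL : ∀ n : N, n ∈ L ↔ Additive.ofMul n ∈ W := fun n => Iff.rfl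
      have hLn : (L.map N.subtype).Normal := by
        refine ⟨?_⟩
        rintro _ ⟨n, hn, rfl⟩ g
        exact ⟨α g n, hW g _ hn, by simp [α]⟩
      rcases hmin _ hLn (map_subtype_le L) with h | h
      · apply hW0
        rw [eq_bot_iff]
        intro v hv
        have h1 : N.subtype v.toMul ∈ L.map N.subtype := mem_map_of_mem _ hv
        rw [h, mem_bot] at h1
        have : v.toMul = 1 := Subtype.ext h1
        exact congrArg Additive.ofMul this
      · apply hW1
        rw [eq_top_iff]
        intro v _
        have h1 : N.subtype v.toMul ∈ L.map N.subtype := by rw [h]; exact v.toMul.2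
        obtain ⟨w, hw, hwv⟩ := h1
        have : w = v.toMul := Subtype.ext hwv
        rw [this] at hw
        exact hw

/-! ### Large cyclic subgroups of `p`-subgroups -/

/-- For each prime `p`, every `p`-subgroup of `G` contains a cyclic subgroup of index
at most `p`. -/
def AlmostCyclicPSubgroups (G : Type*) [Group G] : Prop :=
  ∀ p : ℕ, p.Prime → ∀ Q : Subgroup G, IsPGroup p Q → ∃ x ∈ Q, Nat.card Q ≤ p * orderOf x

section AlmostCyclic

variable {G : Type*} [Group G]

theorem Subgroup.card_mul_relIndex_of_le {H K : Subgroup G} (h : H ≤ K) :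
    Nat.card H * H.relIndex K = Nat.card K := by
  rw [← relIndex_bot_left, ← relIndex_bot_left, relIndex_mul_relIndex _ _ _ bot_le h]

variable [Finite G]

/-- The generator is that of `Q ⊓ zpowers x`, whose index in `Q` is at most the index of `zpowers x`
in `P`. -/
theorem Subgroup.exists_card_le_mul_orderOf_of_le {P Q : Subgroup G} (hQP : Q ≤ P) {p : ℕ} {x : G}
    (hx : x ∈ P) (hP : Nat.card P ≤ p * orderOf x) : ∃ y ∈ Q, Nat.card Q ≤ p * orderOf y := by
  have hle : zpowers x ≤ P := (zpowers_le).2 hx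
  have hcyc : IsCyclic (Q ⊓ zpowers x : Subgroup G) :=
    isCyclic_of_injective (inclusion (inf_le_right : Q ⊓ zpowers x ≤ zpowers x))
      (inclusion_injective _)
  obtain ⟨y, hy⟩ := hcyc.exists_generator
  have hy' : orderOf (y : G) = Nat.card (Q ⊓ zpowers x : Subgroup G) := by
    rw [Subgroup.orderOf_coe]; exact orderOf_eq_card_of_forall_mem_zpowers hy
  have h1 : (zpowers x).relIndex P ≤ p := by
    have h2 : orderOf x * (zpowers x).relIndex P = Nat.card P := by
      rw [← Nat.card_zpowers]; exact card_mul_relIndex_of_le hle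
    refine Nat.le_of_mul_le_mul_left ?_ (orderOf_pos x)
    rwa [h2, mul_comm]
  have h2 : (zpowers x).relIndex Q ≤ p :=
    (relIndex_le_of_le_right hQP (index_ne_zero_of_finite (H := (zpowers x).subgroupOf P))).trans h1
  refine ⟨y, y.2.1, ?_⟩
  rw [hy', ← card_mul_relIndex_of_le (inf_le_left : Q ⊓ zpowers x ≤ Q), inf_relIndex_left, mul_comm]
  exact Nat.mul_le_mul_right _ h2

theorem SylowCyclicOrDihedral.almostCyclicPSubgroups (hG : SylowCyclicOrDihedral G)
    (hodd : Odd (Nat.card G)) : AlmostCyclicPSubgroups G := by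
  intro p hp Q hQ
  have := Fact.mk hp
  by_cases hpG : p ∣ Nat.card G
  · obtain ⟨P, hQP⟩ := hQ.exists_le_sylow
    obtain ⟨H, hH, hcyc⟩ := hG p hp hpG P
    have hcard : Nat.card H ∣ Nat.card G :=
      (card_subgroup_dvd_card H).trans (card_subgroup_dvd_card (P : Subgroup G))
    have hHc : IsCyclic H := by
      refine hcyc.resolve_right ?_
      rintro ⟨n, -, ⟨e⟩⟩
      rw [Nat.card_congr e.toEquiv, DihedralGroup.nat_card] at hcard
      exact Nat.not_even_iff_odd.2 hodd ((even_two_mul n).trans_dvd hcard)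
    have hHi : H.index = p := by
      obtain ⟨k, hk⟩ := P.isPGroup'.index H
      rw [hk] at hH ⊢
      rw [hH.eq_one_of_pow, pow_one]
    obtain ⟨h, hh⟩ := hHc.exists_generator
    refine exists_card_le_mul_orderOf_of_le hQP (x := ((h : P) : G)) h.1.2 ?_
    have h1 : orderOf ((h : P) : G) = Nat.card H := by
      rw [← orderOf_eq_card_of_forall_mem_zpowers hh, ← Subgroup.orderOf_coe h]
      exact Subgroup.orderOf_coe (h : P)
    have h2 : Nat.card H * H.index = Nat.card P := H.card_mul_index
    rw [hHi, mul_comm] at h2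
    rw [h1]
    exact h2.ge
  -- Here `Q` is trivial; the bound is an inequality so that this case is covered.
  · refine ⟨1, Q.one_mem, ?_⟩
    have h1 : Nat.card Q = 1 := by
      refine hQ.card_eq_or_dvd.resolve_right fun h => hpG (h.trans (card_subgroup_dvd_card Q))
    rw [h1, orderOf_one, mul_one]
    exact hp.one_lt.le

/-- Sylow subgroups lift along `f`. Restricting `f` to `P` divides its order by that of the kernel,
and divides the order of `x` by no more than that. -/
theorem AlmostCyclicPSubgroups.of_surjective {H : Type*} [Group H] (hG : AlmostCyclicPSubgroups G)
    (f : G →* H) (hf : Function.Surjective f) : AlmostCyclicPSubgroups H := by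
  intro p hp Q hQ
  have := Fact.mk hp
  have : Finite H := Finite.of_surjective f hf
  obtain ⟨P', hQP⟩ := hQ.exists_le_sylow
  obtain ⟨P, rfl⟩ := Sylow.mapSurjective_surjective hf p P'
  obtain ⟨x, hx, hPx⟩ := hG p hp P P.isPGroup'
  refine exists_card_le_mul_orderOf_of_le hQP (x := f x) (mem_map_of_mem f hx) ?_
  let g : P →* H := f.comp (P : Subgroup G).subtype
  have h1 : Nat.card g.ker * Nat.card ((P : Subgroup G).map f) = Nat.card P := by
    have : (P : Subgroup G).map f = g.range := by
      rw [MonoidHom.range_comp, range_subtype]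
    rw [this, ← index_ker]
    exact g.ker.card_mul_index
  have h2 : orderOf x ∣ orderOf (f x) * Nat.card g.ker := by
    apply orderOf_dvd_of_pow_eq_one
    let x' : g.ker := ⟨⟨x, hx⟩ ^ orderOf (f x), by
      rw [MonoidHom.mem_ker, map_pow]; exact pow_orderOf_eq_one (f x)⟩
    have h3 : x' ^ Nat.card g.ker = 1 := pow_card_eq_one'
    rw [pow_mul]
    exact congrArg (fun t : g.ker => (((t : P)) : G)) h3
  have h3 := Nat.le_of_dvd (mul_pos (orderOf_pos _) Nat.card_pos) h2
  refine Nat.le_of_mul_le_mul_left (?_ : Nat.card g.ker * _ ≤ Nat.card g.ker * _) Nat.card_pos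
  calc Nat.card g.ker * Nat.card ((P : Subgroup G).map f) = Nat.card P := h1
    _ ≤ p * orderOf x := hPx
    _ ≤ p * (orderOf (f x) * Nat.card g.ker) := Nat.mul_le_mul_left p h3
    _ = _ := by ring

end AlmostCyclic

/-! ### Commutativity of the nilpotent residual -/

/-- If the `p`-group `R` is the nilpotent residual of `G`, has class at most two and commutators of
exponent `p`, and contains a cyclic subgroup of index at most `p`, then `R` is abelian. -/
theorem IsNilpotentResidual.commute_of_isPGroup {G : Type*} [Group G] [Finite G] {R : Subgroup G}
    (hR : IsNilpotentResidual R) {p : ℕ} (hp : p.Prime) (hp2 : p ≠ 2) (hRp : IsPGroup p R)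
    (hcl : ∀ a ∈ ⁅R, R⁆, ∀ b ∈ R, Commute a b) (hexp : ∀ a ∈ ⁅R, R⁆, a ^ p = 1)
    {x : G} (hx : x ∈ R) (hxc : Nat.card R ≤ p * orderOf x) :
    ∀ a ∈ R, ∀ b ∈ R, Commute a b := by
  by_contra! hna
  have hn := hR.normal
  have hmem : ∀ a b : R, ((⁅a, b⁆ : R) : G) ∈ ⁅R, R⁆ := fun a b =>
    commutator_mem_commutator a.2 b.2
  obtain ⟨y, ⟨u, hu⟩, hy⟩ := exists_not_commute_forall_mulEquiv_div_mem (S := R) hp hp2 hRp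
    (fun a b c => Subtype.ext (hcl _ (hmem a b) c c.2).eq)
    (fun a b => Subtype.ext (by simpa using hexp _ (hmem a b)))
    (x := ⟨x, hx⟩) (by rwa [← Subgroup.orderOf_coe]) (by
      intro h
      obtain ⟨a, ha, b, hb, hab⟩ := hna
      exact hab (congrArg Subtype.val (h ⟨a, ha⟩ ⟨b, hb⟩).eq))
  set N := ⁅R, R⁆ with hN
  have hsplit := (hR.map _ (QuotientGroup.mk'_surjective N)).splitsCentrally (by
    rintro _ ⟨a, ha, rfl⟩ _ ⟨b, hb, rfl⟩
    rw [← commutatorElement_eq_one_iff_mul_comm, ← map_commutatorElement,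
      QuotientGroup.mk'_apply, QuotientGroup.eq_one_iff]
    exact commutator_mem_commutator ha hb)
  -- Conjugations by `G` fix `y` modulo `N`, so `yN` is central and lies in the abelian residual of
  -- `G ⧸ N`.
  have hyN : (y : G) ∈ N := by
    rw [← QuotientGroup.eq_one_iff, ← QuotientGroup.mk'_apply, ← mem_bot, ← hsplit.inf_center]
    refine ⟨mem_map_of_mem _ y.2, mem_center_iff.2 fun g => ?_⟩
    obtain ⟨g, rfl⟩ := QuotientGroup.mk'_surjective N g
    rw [← commutatorElement_eq_one_iff_mul_comm, ← map_commutatorElement,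
      QuotientGroup.mk'_apply, QuotientGroup.eq_one_iff, hN, ← map_subtype_commutator]
    refine ⟨_, hy (MulAut.conjNormal g), ?_⟩
    simp [commutatorElement_def]
  exact hu (Subtype.ext (hcl _ hyN u u.2).eq.symm)

/-- The nilpotent residual of a solvable group of odd order whose `p`-subgroups are almost cyclic
is abelian. -/
theorem IsNilpotentResidual.commute_of_almostCyclic {G : Type*} [Group G] [Finite G]
    (hsol : Group.IsSolvable G) (hodd : Odd (Nat.card G)) (hG : AlmostCyclicPSubgroups G)
    {R : Subgroup G} (hR : IsNilpotentResidual R) : ∀ a ∈ R, ∀ b ∈ R, Commute a b := by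
  induction hcard : Nat.card G using Nat.strong_induction_on generalizing G with
  | _ n ih =>
  by_contra! hna
  have hRn := hR.normal
  set N := ⁅R, R⁆ with hN
  have hNn : N.Normal := inferInstance
  have hNbot : N ≠ ⊥ := by
    intro h
    obtain ⟨a, ha, b, hb, hab⟩ := hna
    have : ⁅a, b⁆ ∈ N := commutator_mem_commutator ha hb
    rw [h, mem_bot] at this
    exact hab (commutatorElement_eq_one_iff_commute.1 this)
  -- By induction `R` becomes abelian in `G ⧸ M`, so `⁅R, R⁆ ≤ M`.
  have hNmin : ∀ M : Subgroup G, M.Normal → M ≠ ⊥ → N ≤ M := by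
    intro M _ hM
    have hsurj := QuotientGroup.mk'_surjective M
    have := ih _ (hcard ▸ card_quotient_lt_of_ne_bot hM) (G := G ⧸ M) inferInstance
      (hodd.of_dvd_nat (card_quotient_dvd_card M)) (hG.of_surjective _ hsurj)
      (hR.map _ hsurj) rfl
    rw [hN, commutator_le]
    intro a ha b hb
    rw [← QuotientGroup.eq_one_iff, ← QuotientGroup.mk'_apply, map_commutatorElement]
    exact commutatorElement_eq_one_iff_commute.2
      (this _ (mem_map_of_mem _ ha) _ (mem_map_of_mem _ hb))
  have hNcomm : ∀ a ∈ N, ∀ b ∈ N, a * b = b * a := by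
    have h1 : ⁅N, N⁆ = ⊥ := by
      by_contra h
      exact (Group.IsSolvable.commutator_lt_of_ne_bot hNbot).not_ge (hNmin _ inferInstance h)
    intro a ha b hb
    rw [← commutatorElement_eq_one_iff_mul_comm, ← mem_bot, ← h1]
    exact commutator_mem_commutator ha hb
  obtain ⟨p, hp, hpN⟩ := Nat.exists_prime_and_dvd ((one_lt_card_iff_ne_bot N).2 hNbot).ne'
  have := Fact.mk hp
  have hp2 : p ≠ 2 := by
    rintro rfl
    exact Nat.not_even_iff_odd.2 hodd
      (even_iff_two_dvd.2 (hpN.trans (card_subgroup_dvd_card N)))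
  have hNexp : ∀ a ∈ N, a ^ p = 1 := by
    let M : Subgroup G :=
      { carrier := {a | a ∈ N ∧ a ^ p = 1}
        one_mem' := ⟨N.one_mem, one_pow p⟩
        mul_mem' := fun {a b} ha hb => ⟨N.mul_mem ha.1 hb.1, by
          rw [(show Commute a b from hNcomm a ha.1 b hb.1).mul_pow, ha.2, hb.2, one_mul]⟩
        inv_mem' := fun {a} ha => ⟨N.inv_mem ha.1, by rw [inv_pow, ha.2, inv_one]⟩ }
    have hM : M.Normal := ⟨fun a ha g => ⟨hNn.conj_mem a ha.1 g, by
      rw [conj_pow, ha.2, mul_one, mul_inv_cancel]⟩⟩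
    have hMbot : M ≠ ⊥ := by
      obtain ⟨a, ha⟩ := exists_prime_orderOf_dvd_card' p hpN
      intro h
      have h1 : (a : G) ∈ M := ⟨a.2, by
        rw [← ha, ← Subgroup.orderOf_coe, pow_orderOf_eq_one]⟩
      rw [h, mem_bot] at h1
      rw [← Subgroup.orderOf_coe, h1, orderOf_one] at ha
      exact hp.one_lt.ne ha
    exact fun a ha => (hNmin M hM hMbot ha).2
  have hNp : IsPGroup p N := fun a => ⟨1, Subtype.ext (by simpa using hNexp a a.2)⟩
  -- In exponent `p` the large cyclic subgroup has order at most `p`.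
  have hNcard : Nat.card N ≤ p ^ 2 := by
    obtain ⟨x, hx, hxc⟩ := hG p hp N hNp
    have := Nat.le_of_dvd hp.pos (orderOf_dvd_of_pow_eq_one (hNexp x hx))
    calc Nat.card N ≤ p * orderOf x := hxc
      _ ≤ p * p := Nat.mul_le_mul_left p this
      _ = p ^ 2 := (sq p).symm
  have hRN : ∀ a ∈ R, ∀ b ∈ N, Commute a b := by
    refine hR.commute_of_card_le_sq hodd hNn (fun M hM hMN => ?_) hNcomm hp hp2 hNexp hNcard ?_
    · by_cases h : M = ⊥
      · exact Or.inl h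
      · exact Or.inr (le_antisymm hMN (hNmin M hM h))
    · exact fun a ha b hb n hn => hNcomm _ (commutator_mem_commutator ha hb) n hn
  have hRnil : Group.IsNilpotent R := by
    refine Subgroup.isNilpotent_of_ker_le_center (Abelianization.of (G := R)) ?_
    rw [Abelianization.ker_of]
    intro a ha
    have h1 : (a : G) ∈ N := by
      rw [hN, ← map_subtype_commutator]; exact mem_map_of_mem R.subtype ha
    exact mem_center_iff.2 fun g => Subtype.ext (hRN g g.2 a h1).eq
  have hRp : IsPGroup p R := by
    refine IsPGroup.of_card (n := (Nat.card R).primeFactorsList.length)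
      (Nat.eq_prime_pow_of_unique_prime_dvd Nat.card_pos.ne' fun {q} hq hqR => ?_)
    by_contra hqp
    have := Fact.mk hq
    let S : Sylow q R := default
    have hS : (S : Subgroup R) ≠ ⊥ := S.ne_bot_of_dvd_card hqR
    -- Being characteristic in `R`, `S` is normal in `G`, so it would contain the nontrivial
    -- `p`-group `N`.
    have hSc : (S : Subgroup R).Characteristic := S.characteristic_of_normal inferInstance
    have hSq : IsPGroup q ((S : Subgroup R).map R.subtype) := S.isPGroup'.map R.subtype
    have hSbot : (S : Subgroup R).map R.subtype ≠ ⊥ := by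
      rwa [Ne, map_eq_bot_iff_of_injective _ R.subtype_injective]
    have hle := hNmin _ inferInstance hSbot
    refine hNbot ?_
    have := (IsPGroup.disjoint_of_ne q p hqp _ _ hSq hNp).eq_bot
    rwa [inf_eq_right.2 hle] at this
  obtain ⟨x, hx, hxc⟩ := hG p hp R hRp
  obtain ⟨a, ha, b, hb, hab⟩ := hna
  exact hab (hR.commute_of_isPGroup hp hp2 hRp (fun a ha b hb => (hRN b hb a ha).symm) hNexp
    hx hxc a ha b hb)

theorem lemma5p4 {G : Type*} [Group G] [Finite G]
    (hsol : Group.IsSolvable G) (hodd : Odd (Nat.card G)) (hG : SylowCyclicOrDihedral G) :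
    ∃ C D : Subgroup G, IsInternalSemidirect C D ∧ IsMulCommutative C ∧
      Group.IsNilpotent D ∧ C ⊓ Subgroup.center G = ⊥ := by
  obtain ⟨C, hC⟩ := IsNilpotentResidual.exists_of_finite G
  have hcomm := hC.commute_of_almostCyclic hsol hodd (hG.almostCyclicPSubgroups hodd)
  obtain ⟨⟨D, hCD, hCD'⟩, hZ⟩ := hC.splitsCentrally hcomm
  have hn := hC.normal
  have hnil := hC.isNilpotent_quotient
  refine ⟨C, D, ⟨hn, ?_⟩, ⟨⟨fun a b => Subtype.ext (hcomm a a.2 b b.2).eq⟩⟩, ?_, hZ⟩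
  · apply isComplement'_of_disjoint_and_mul_eq_univ (disjoint_iff.2 hCD)
    rw [← normal_mul, hCD', coe_top]
  -- `D` embeds in the nilpotent group `G ⧸ C`.
  · refine Subgroup.isNilpotent_of_ker_le_center ((QuotientGroup.mk' C).comp D.subtype) ?_
    intro d hd
    have h1 : (d : G) ∈ C ⊓ D := ⟨(QuotientGroup.eq_one_iff (d : G)).1 hd, d.2⟩
    rw [hCD, mem_bot] at h1
    have h2 : d = 1 := Subtype.ext h1
    rw [h2]
    exact one_mem _
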